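/- For a regular cardinal $\delta\ge\omega_2$ let $E_\omega^\delta=\{\alpha<\delta : \operatorname{cf}(\alpha)=\omega\}$, and let $F^+(\delta)$ be the statement that for every stationary set $A\subseteq E_\omega^\delta$ there is a normal (i.e. strictly increasing and continuous) function $f\colon\omega_1\to\delta$ with $f[\omega_1]\subseteq A$. For cardinals $\kappa\le\lambda$, say that $\kappa$ is $\lambda$-supercompact if there are a transitive class $M$ with ${}^{\lambda}M\subseteq M$ and an elementary embedding $j\colon V\to M$ with critical point $\kappa$ and $j(\kappa)>\lambda$. Theorem. Let $\kappa\le\lambda$ be cardinals such that $\lambda$ is regular and $\kappa$ is $\lambda$-supercompact. Assume that $F^+(\delta)$ fails for every regular cardinal $\delta$ with $\omega_2\le\delta<\kappa$. Then $F^+(\lambda)$ fails. -/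

import Mathlib

open Cardinal Ordinal Order FirstOrder

universe u

/-! ### The language of set theory and classes as structures for it -/

/-- The only nonlogical symbol of the language of set theory: a binary relation symbol. -/
inductive SetLangRel : ℕ → Type
  | mem : SetLangRel 2

/-- The first-order language `{∈}` of set theory. -/
def setLanguage : FirstOrder.Language.{0, 0} := ⟨fun _ => Empty, SetLangRel⟩

/-- The universe `V` of sets, as the structure `(V, ∈)`. -/
instance universeStructure : setLanguage.Structure ZFSet.{u} where
  funMap := fun f => Empty.elim f
  RelMap | .mem => fun x => x 0 ∈ x 1

/-- A class `M` of sets, as the structure `(M, ∈)`. -/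
instance classStructure (M : Set ZFSet.{u}) : setLanguage.Structure M where
  funMap := fun f => Empty.elim f
  RelMap | .mem => fun x => (x 0 : ZFSet.{u}) ∈ (x 1 : ZFSet.{u})

/-! ### Supercompactness -/

/-- `M` is a transitive class. -/
def IsTransitiveClass (M : Set ZFSet.{u}) : Prop :=
  ∀ x ∈ M, ∀ y ∈ x, y ∈ M

/-- The von Neumann ordinal that is the initial ordinal of the cardinal `c`. -/
noncomputable def cardSet (c : Cardinal.{u}) : ZFSet.{u} :=
  c.ord.toZFSet

/-- `^λM ⊆ M`: every function with domain `λ` and all values in `M` is an element of `M`. -/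
def ClosedUnderSeq (lam : Cardinal.{u}) (M : Set ZFSet.{u}) : Prop :=
  ∀ y f : ZFSet.{u}, (∀ z ∈ y, z ∈ M) → ZFSet.IsFunc (cardSet lam) y f → f ∈ M

/-- `κ` is `λ`-supercompact: there are a transitive class `M` with `^λM ⊆ M` and an elementary
embedding `j : V → M` with critical point `κ` and `j(κ) > λ`. -/
def IsSupercompactUpTo (kappa lam : Cardinal.{u}) : Prop :=
  ∃ (M : Set ZFSet.{u}) (j : ZFSet.{u} ↪ₑ[setLanguage] M),
    IsTransitiveClass M ∧
    ClosedUnderSeq lam M ∧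
    (∀ α < kappa.ord, (j α.toZFSet : ZFSet.{u}) = α.toZFSet) ∧
    (j (cardSet kappa) : ZFSet.{u}) ≠ cardSet kappa ∧
    cardSet lam ∈ (j (cardSet kappa) : ZFSet.{u})

/-! ### The Friedman property -/

/-- `E_ω^δ`: the ordinals below `δ` of cofinality `ω`. -/
def cofOmega (δ : Ordinal.{u}) : Set (Set.Iio δ) :=
  {α | (α : Ordinal.{u}).cof = ℵ₀}

/-- `F⁺(δ)`, for a regular cardinal `δ ≥ ω₂`: for every stationary subset `A` of `E_ω^δ` there is a
normal function `f : ω₁ → δ` with all values in `A`, that is, `A` contains a closed copy of `ω₁`. -/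
def FriedmanPlus (δ : Cardinal.{u}) : Prop :=
  ∀ A : Set (Set.Iio δ.ord), A ⊆ cofOmega δ.ord → IsStationary A →
    ∃ f : Set.Iio (ω_ 1 : Ordinal.{u}) → Set.Iio δ.ord, IsNormal f ∧ ∀ i, f i ∈ A

/-!
The proof is a reflection argument. Let `j : V → M` witness that `κ` is `λ`-supercompact. The
hypothesis says in `V` that `F⁺` fails at every regular `δ ∈ κ` with `ω₁ ∈ δ`. By elementarity, `M`
believes the same with `j(κ)` in place of `κ`. The ordinal `λ` lies in `j(κ)`, and being regular it
is regular in `M`, since every function in `M` is one in `V`; so `M` believes that `F⁺(λ)` fails. A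
witness `A ∈ M` is a witness in `V`: as `M` is closed under `λ`-sequences, it contains every club of
`λ`, so `A` is stationary, and it contains the graph of every `f : ω₁ → λ`, so no normal function
has all its values in `A` (`not_friedmanPlus_of_friedmanFailsIn`).

For this, `ω` and `ω₁` must be fixed by `j`, that is, `ω₁ < κ`
(`IsSupercompactUpTo.aleph_one_lt`). If `κ ≤ ω`, then no element of `κ` is a limit ordinal, but
`λ ∈ j(κ)` is one; if `κ = ω₁`, then every element of `κ` has cofinality at most `ω`, but `λ` has
not.

The set-theoretic notions are predicates in an arbitrary structure for the language `{∈}`.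
`IsFirstOrder` records that a predicate is expressed by a formula; it is closed under connectives
and quantifiers, so formulas need not be written out, and `IsFirstOrder.transfer` moves predicates
along `j`. `IsTransitiveEmbedding` covers `V` and `M` at once: the lemmas on it compare the
predicates with the notions of Mathlib. Regularity and cofinality `ω` are expressed through partial
cofinal maps between ordinals (`CofinalMapIn`), for which downward absoluteness suffices on the side
of `M` (`IsTransitiveEmbedding.cof_le_of_cofinalMapIn`).
-/

/-! ### First-order definable predicates -/

/-- The interpretation of the membership symbol in a structure for the language of set theory. -/
def SetMem {S : Type*} [setLanguage.Structure S] (x y : S) : Prop :=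
  FirstOrder.Language.Structure.RelMap (L := setLanguage) SetLangRel.mem ![x, y]

local infix:50 " ∈' " => SetMem

/-- A predicate of `n` variables, given uniformly in all structures for the language of set theory,
is first-order if one formula expresses it in every structure. -/
def IsFirstOrder {n : ℕ}
    (P : ∀ (S : Type (u + 1)) [setLanguage.Structure S], (Fin n → S) → Prop) : Prop :=
  ∃ φ : setLanguage.BoundedFormula Empty n,
    ∀ (S : Type (u + 1)) [setLanguage.Structure S] (v : Fin n → S),
      φ.Realize (default : Empty → S) v ↔ P S v

namespace IsFirstOrder

variable {n : ℕ} {P Q : ∀ (S : Type (u + 1)) [setLanguage.Structure S], (Fin n → S) → Prop}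

theorem mem (i j : Fin n) : IsFirstOrder.{u} fun _ _ v => v i ∈' v j := by
  let R : setLanguage.Relations 2 := SetLangRel.mem
  exact ⟨R.boundedFormula₂ (FirstOrder.Language.Term.var (Sum.inr i))
    (FirstOrder.Language.Term.var (Sum.inr j)),
    fun _ _ _ => FirstOrder.Language.BoundedFormula.realize_rel₂⟩

theorem eq (i j : Fin n) : IsFirstOrder.{u} fun _ _ v => v i = v j :=
  ⟨(FirstOrder.Language.Term.var (Sum.inr i)).bdEqual (FirstOrder.Language.Term.var (Sum.inr j)),
    fun S _ v => by simp⟩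

theorem imp (hP : IsFirstOrder.{u} P) (hQ : IsFirstOrder.{u} Q) :
    IsFirstOrder.{u} fun S _ v => P S v → Q S v := by
  obtain ⟨φ, hφ⟩ := hP
  obtain ⟨ψ, hψ⟩ := hQ
  exact ⟨φ.imp ψ, fun S _ v => by rw [FirstOrder.Language.BoundedFormula.realize_imp, hφ, hψ]⟩

theorem not (hP : IsFirstOrder.{u} P) : IsFirstOrder.{u} fun S _ v => ¬ P S v := by
  obtain ⟨φ, hφ⟩ := hP
  exact ⟨φ.not, fun S _ v => by rw [FirstOrder.Language.BoundedFormula.realize_not, hφ]⟩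

theorem and (hP : IsFirstOrder.{u} P) (hQ : IsFirstOrder.{u} Q) :
    IsFirstOrder.{u} fun S _ v => P S v ∧ Q S v := by
  obtain ⟨φ, hφ⟩ := hP
  obtain ⟨ψ, hψ⟩ := hQ
  exact ⟨φ ⊓ ψ, fun S _ v => by rw [FirstOrder.Language.BoundedFormula.realize_inf, hφ, hψ]⟩

theorem or (hP : IsFirstOrder.{u} P) (hQ : IsFirstOrder.{u} Q) :
    IsFirstOrder.{u} fun S _ v => P S v ∨ Q S v := by
  obtain ⟨φ, hφ⟩ := hP
  obtain ⟨ψ, hψ⟩ := hQ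
  exact ⟨φ ⊔ ψ, fun S _ v => by rw [FirstOrder.Language.BoundedFormula.realize_sup, hφ, hψ]⟩

theorem iff (hP : IsFirstOrder.{u} P) (hQ : IsFirstOrder.{u} Q) :
    IsFirstOrder.{u} fun S _ v => P S v ↔ Q S v := by
  obtain ⟨φ, hφ⟩ := hP
  obtain ⟨ψ, hψ⟩ := hQ
  exact ⟨φ.iff ψ, fun S _ v => by rw [FirstOrder.Language.BoundedFormula.realize_iff, hφ, hψ]⟩

theorem all {R : ∀ (S : Type (u + 1)) [setLanguage.Structure S], (Fin n → S) → S → Prop}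
    (hR : IsFirstOrder.{u} fun S _ (v : Fin (n + 1) → S) => R S (Fin.init v) (v (Fin.last n))) :
    IsFirstOrder.{u} fun S _ v => ∀ a : S, R S v a := by
  obtain ⟨φ, hφ⟩ := hR
  refine ⟨φ.all, fun S _ v => ?_⟩
  rw [FirstOrder.Language.BoundedFormula.realize_all]
  simp [hφ]

theorem ex {R : ∀ (S : Type (u + 1)) [setLanguage.Structure S], (Fin n → S) → S → Prop}
    (hR : IsFirstOrder.{u} fun S _ (v : Fin (n + 1) → S) => R S (Fin.init v) (v (Fin.last n))) :
    IsFirstOrder.{u} fun S _ v => ∃ a : S, R S v a := by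
  obtain ⟨φ, hφ⟩ := hR
  refine ⟨φ.ex, fun S _ v => ?_⟩
  rw [FirstOrder.Language.BoundedFormula.realize_ex]
  simp [hφ]

/-- First-order predicates are preserved and reflected by elementary embeddings. -/
theorem transfer (hP : IsFirstOrder.{u} P) {S T : Type (u + 1)} [setLanguage.Structure S]
    [setLanguage.Structure T] (j : S ↪ₑ[setLanguage] T) (v : Fin n → S) :
    P T (j ∘ v) ↔ P S v := by
  obtain ⟨φ, hφ⟩ := hP
  rw [← hφ, ← hφ, ← j.map_boundedFormula φ default v]
  exact iff_of_eq (congrArg (fun w => φ.Realize w (j ∘ v)) (Subsingleton.elim _ _))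

end IsFirstOrder

/-! ### The set-theoretic notions, interpreted in a structure -/

section Predicates

variable {S : Type (u + 1)} [setLanguage.Structure S]

/-- `p` is the Kuratowski pair `{{a}, {a, b}}`. -/
def IsPairIn (p a b : S) : Prop :=
  ∃ x y, x ∈' p ∧ y ∈' p ∧ (∀ z, z ∈' p → z = x ∨ z = y) ∧ (∀ w, w ∈' x ↔ w = a) ∧
    ∀ w, w ∈' y ↔ w = a ∨ w = b

/-- The pair `(a, b)` belongs to `r`. -/
def PairMemIn (r a b : S) : Prop :=
  ∃ p, p ∈' r ∧ IsPairIn p a b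

/-- For ordinals `b` and `d`: some partial function from `b` to `d` is cofinal in `d`. -/
def CofinalMapIn (b d : S) : Prop :=
  ∃ r : S, (∀ i y z, PairMemIn r i y → PairMemIn r i z → y = z) ∧
    ∀ x, x ∈' d → ∃ i y, i ∈' b ∧ y ∈' d ∧ PairMemIn r i y ∧ (x ∈' y ∨ x = y)

/-- For an ordinal `d`: `d` is a nonzero limit. -/
def LimitIn (d : S) : Prop :=
  (∃ x, x ∈' d) ∧ ∀ x, x ∈' d → ∃ y, y ∈' d ∧ x ∈' y

/-- `c` contains every point of `d` that is a limit of points of `c`, and it is unbounded in `d`. -/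
def ClubIn (c d : S) : Prop :=
  (∀ x, x ∈' d → ∃ y, y ∈' d ∧ y ∈' c ∧ (x ∈' y ∨ x = y)) ∧
    ∀ x, x ∈' d → (∃ y, y ∈' c ∧ y ∈' x) →
      (∀ z, z ∈' x → ∃ y, y ∈' c ∧ y ∈' x ∧ z ∈' y) → x ∈' c

/-- `a` is stationary in `d`. -/
def StationaryIn (a d : S) : Prop :=
  ∀ c, ClubIn c d → ∃ x, x ∈' a ∧ x ∈' c

/-- Some normal function with domain the ordinal `w` has all its values in `a`. -/
def NormalCopyIn (w a : S) : Prop :=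
  ∃ f : S, (∀ i, i ∈' w → ∃ y, y ∈' a ∧ PairMemIn f i y) ∧
    (∀ i y z, PairMemIn f i y → PairMemIn f i z → y = z) ∧
    (∀ i k y z, i ∈' w → k ∈' w → i ∈' k → PairMemIn f i y → PairMemIn f k z → y ∈' z) ∧
    ∀ i y, i ∈' w → LimitIn i → PairMemIn f i y →
      ∀ z, z ∈' y → ∃ k x, k ∈' i ∧ PairMemIn f k x ∧ z ∈' x

/-- `F⁺` fails at the ordinal `d`, where `o` and `w` are the ordinals `ω` and `ω₁`. -/
def FriedmanFailsIn (o w d : S) : Prop :=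
  ∃ a : S, (∀ x, x ∈' a → x ∈' d ∧ LimitIn x ∧ CofinalMapIn o x) ∧ StationaryIn a d ∧
    ¬ NormalCopyIn w a

end Predicates

namespace IsFirstOrder

variable {n : ℕ}

theorem isPairIn (i j k : Fin n) : IsFirstOrder.{u} fun _ _ v => IsPairIn (v i) (v j) (v k) :=
  ex (ex (and (mem _ _) (and (mem _ _) (and (all (imp (mem _ _) (or (eq _ _) (eq _ _))))
    (and (all (iff (mem _ _) (eq _ _))) (all (iff (mem _ _) (or (eq _ _) (eq _ _)))))))))

theorem pairMemIn (i j k : Fin n) : IsFirstOrder.{u} fun _ _ v => PairMemIn (v i) (v j) (v k) :=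
  ex (and (mem _ _) (isPairIn _ _ _))

theorem cofinalMapIn (i j : Fin n) : IsFirstOrder.{u} fun _ _ v => CofinalMapIn (v i) (v j) :=
  ex (and (all (all (all (imp (pairMemIn _ _ _) (imp (pairMemIn _ _ _) (eq _ _))))))
    (all (imp (mem _ _) (ex (ex (and (mem _ _) (and (mem _ _) (and (pairMemIn _ _ _)
      (or (mem _ _) (eq _ _))))))))))

theorem limitIn (i : Fin n) : IsFirstOrder.{u} fun _ _ v => LimitIn (v i) :=
  and (ex (mem _ _)) (all (imp (mem _ _) (ex (and (mem _ _) (mem _ _)))))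

theorem clubIn (i j : Fin n) : IsFirstOrder.{u} fun _ _ v => ClubIn (v i) (v j) :=
  and (all (imp (mem _ _) (ex (and (mem _ _) (and (mem _ _) (or (mem _ _) (eq _ _)))))))
    (all (imp (mem _ _) (imp (ex (and (mem _ _) (mem _ _)))
      (imp (all (imp (mem _ _) (ex (and (mem _ _) (and (mem _ _) (mem _ _)))))) (mem _ _)))))

theorem stationaryIn (i j : Fin n) : IsFirstOrder.{u} fun _ _ v => StationaryIn (v i) (v j) :=
  all (imp (clubIn _ _) (ex (and (mem _ _) (mem _ _))))

theorem normalCopyIn (i j : Fin n) : IsFirstOrder.{u} fun _ _ v => NormalCopyIn (v i) (v j) :=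
  ex (and (all (imp (mem _ _) (ex (and (mem _ _) (pairMemIn _ _ _)))))
    (and (all (all (all (imp (pairMemIn _ _ _) (imp (pairMemIn _ _ _) (eq _ _))))))
      (and (all (all (all (all (imp (mem _ _) (imp (mem _ _) (imp (mem _ _)
          (imp (pairMemIn _ _ _) (imp (pairMemIn _ _ _) (mem _ _))))))))))
        (all (all (imp (mem _ _) (imp (limitIn _) (imp (pairMemIn _ _ _)
          (all (imp (mem _ _) (ex (ex (and (mem _ _) (and (pairMemIn _ _ _) (mem _ _)))))))))))))))

theorem friedmanFailsIn (i j k : Fin n) :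
    IsFirstOrder.{u} fun _ _ v => FriedmanFailsIn (v i) (v j) (v k) :=
  ex (and (all (imp (mem _ _) (and (mem _ _) (and (limitIn _) (cofinalMapIn _ _)))))
    (and (stationaryIn _ _) (not (normalCopyIn _ _))))

end IsFirstOrder

/-! ### Absoluteness between transitive classes and the universe -/

/-- `ι` identifies the structure `S` with a transitive class of sets. -/
structure IsTransitiveEmbedding {S : Type (u + 1)} [setLanguage.Structure S]
    (ι : S → ZFSet.{u}) : Prop where
  injective : Function.Injective ι
  mem_iff : ∀ x y, x ∈' y ↔ ι x ∈ ι y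
  exists_of_mem : ∀ x, ∀ z ∈ ι x, ∃ y, ι y = z

theorem isTransitiveEmbedding_id : IsTransitiveEmbedding (id : ZFSet.{u} → ZFSet.{u}) :=
  ⟨Function.injective_id, fun _ _ => Iff.rfl, fun _ z _ => ⟨z, rfl⟩⟩

theorem IsTransitiveClass.isTransitiveEmbedding {M : Set ZFSet.{u}} (hM : IsTransitiveClass M) :
    IsTransitiveEmbedding (Subtype.val : M → ZFSet.{u}) :=
  ⟨Subtype.val_injective, fun _ _ => Iff.rfl, fun x z hz => ⟨⟨z, hM x x.2 z hz⟩, rfl⟩⟩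

theorem isSuccLimit_iff_exists_between {α : Type*} [LinearOrder α] {o : α} :
    IsSuccLimit o ↔ (∃ b, b < o) ∧ ∀ b < o, ∃ c < o, b < c := by
  rw [Order.isSuccLimit_iff, not_isMin_iff]
  unfold IsSuccPrelimit CovBy
  grind

namespace IsTransitiveEmbedding

variable {S : Type (u + 1)} [setLanguage.Structure S] {ι : S → ZFSet.{u}}
  (hι : IsTransitiveEmbedding ι)

include hι

theorem mem_ordinal_iff {x y : S} {α : Ordinal.{u}} (hx : ι x = α.toZFSet) :
    y ∈' x ↔ ∃ β < α, ι y = β.toZFSet := by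
  rw [hι.mem_iff, hx, mem_toZFSet_iff]
  simp only [eq_comm]

theorem exists_ordinal {x : S} {α β : Ordinal.{u}} (hx : ι x = α.toZFSet) (h : β < α) :
    ∃ y, ι y = β.toZFSet :=
  hι.exists_of_mem x _ (by rwa [hx, toZFSet_mem_toZFSet_iff])

theorem mem_iff_lt {x y : S} {α β : Ordinal.{u}} (hx : ι x = α.toZFSet) (hy : ι y = β.toZFSet) :
    x ∈' y ↔ α < β := by
  rw [hι.mem_iff, hx, hy, toZFSet_mem_toZFSet_iff]

theorem eq_iff_ordinal_eq {x y : S} {α β : Ordinal.{u}} (hx : ι x = α.toZFSet)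
    (hy : ι y = β.toZFSet) : x = y ↔ α = β := by
  rw [← hι.injective.eq_iff, hx, hy, toZFSet_injective.eq_iff]

theorem isPairIn_iff {p a b : S} : IsPairIn p a b ↔ ι p = ZFSet.pair (ι a) (ι b) := by
  have key : ∀ (x : S) (P : ZFSet.{u} → Prop), (∀ z, P z → ∃ w, ι w = z) →
      ((∀ w, w ∈' x ↔ P (ι w)) ↔ ∀ z, z ∈ ι x ↔ P z) := by
    intro x P hP
    refine ⟨fun h z => ⟨fun hz => ?_, fun hz => ?_⟩, fun h w => by rw [hι.mem_iff, h]⟩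
    · obtain ⟨w, rfl⟩ := hι.exists_of_mem x z hz
      rwa [← h, hι.mem_iff]
    · obtain ⟨w, rfl⟩ := hP z hz
      rwa [← hι.mem_iff, h]
  have single : ∀ x : S, (∀ w, w ∈' x ↔ w = a) ↔ ι x = {ι a} := by
    intro x
    simp_rw [← hι.injective.eq_iff]
    rw [ZFSet.ext_iff]
    simp_rw [ZFSet.mem_singleton]
    exact key x (· = ι a) (fun z hz => ⟨a, hz.symm⟩)
  have double : ∀ x : S, (∀ w, w ∈' x ↔ w = a ∨ w = b) ↔ ι x = {ι a, ι b} := by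
    intro x
    simp_rw [← hι.injective.eq_iff]
    rw [ZFSet.ext_iff]
    simp_rw [ZFSet.mem_pair]
    exact key x (fun z => z = ι a ∨ z = ι b)
      (fun z hz => hz.elim (fun h => ⟨a, h.symm⟩) (fun h => ⟨b, h.symm⟩))
  unfold IsPairIn
  simp_rw [single, double, ZFSet.pair]
  constructor
  · rintro ⟨x, y, hx, hy, h, hxa, hyb⟩
    ext z
    rw [ZFSet.mem_pair, ← hxa, ← hyb]
    constructor
    · intro hz
      obtain ⟨w, rfl⟩ := hι.exists_of_mem p z hz
      rcases h w ((hι.mem_iff _ _).2 hz) with rfl | rfl <;> simp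
    · rintro (rfl | rfl)
      · exact (hι.mem_iff _ _).1 hx
      · exact (hι.mem_iff _ _).1 hy
  · intro h
    obtain ⟨x, hx⟩ := hι.exists_of_mem p {ι a} (by simp [h])
    obtain ⟨y, hy⟩ := hι.exists_of_mem p {ι a, ι b} (by simp [h])
    refine ⟨x, y, ?_, ?_, ?_, hx, hy⟩
    · rw [hι.mem_iff, h, hx]; simp
    · rw [hι.mem_iff, h, hy]; simp
    · intro z hz
      rw [hι.mem_iff, h, ZFSet.mem_pair, ← hx, ← hy] at hz
      exact hz.imp (fun h => hι.injective h) (fun h => hι.injective h)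

theorem pairMemIn_iff {r a b : S} : PairMemIn r a b ↔ ZFSet.pair (ι a) (ι b) ∈ ι r := by
  unfold PairMemIn
  simp_rw [hι.isPairIn_iff, hι.mem_iff]
  constructor
  · rintro ⟨p, hp, h⟩
    rwa [← h]
  · intro h
    obtain ⟨p, hp⟩ := hι.exists_of_mem r _ h
    exact ⟨p, by rwa [hp], hp⟩

theorem limitIn_iff {d : S} {δ : Ordinal.{u}} (hd : ι d = δ.toZFSet) :
    LimitIn d ↔ IsSuccLimit δ := by
  unfold LimitIn
  rw [isSuccLimit_iff_exists_between]
  simp_rw [hι.mem_ordinal_iff hd]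
  constructor
  · rintro ⟨⟨x, β, hβ, -⟩, h⟩
    refine ⟨⟨β, hβ⟩, fun γ hγ => ?_⟩
    obtain ⟨y, hy⟩ := hι.exists_ordinal hd hγ
    obtain ⟨z, ⟨ζ, hζ, hz⟩, hyz⟩ := h y ⟨γ, hγ, hy⟩
    exact ⟨ζ, hζ, (hι.mem_iff_lt hy hz).1 hyz⟩
  · rintro ⟨⟨β, hβ⟩, h⟩
    refine ⟨?_, ?_⟩
    · obtain ⟨y, hy⟩ := hι.exists_ordinal hd hβ
      exact ⟨y, β, hβ, hy⟩
    · rintro x ⟨γ, hγ, hx⟩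
      obtain ⟨ζ, hζ, hlt⟩ := h γ hγ
      obtain ⟨y, hy⟩ := hι.exists_ordinal hd hζ
      exact ⟨y, ⟨ζ, hζ, hy⟩, (hι.mem_iff_lt hx hy).2 hlt⟩

/-- Cofinal maps in a transitive class are genuine; the converse fails if the class has too few. -/
theorem cof_le_of_cofinalMapIn {b d : S} {β δ : Ordinal.{u}} (hb : ι b = β.toZFSet)
    (hd : ι d = δ.toZFSet) (h : CofinalMapIn b d) : δ.cof ≤ β.card := by
  obtain ⟨r, hfun, hcof⟩ := h
  by_contra! hlt
  have hδ : 0 < δ := by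
    rw [← Ordinal.cof_pos]
    exact zero_le.trans_lt hlt
  have hex : ∀ i : Set.Iio β, ∃ y < δ, ∀ z < δ,
      ZFSet.pair i.1.toZFSet z.toZFSet ∈ ι r → z = y := by
    intro i
    by_cases hi : ∃ y < δ, ZFSet.pair i.1.toZFSet y.toZFSet ∈ ι r
    · obtain ⟨y, hy, hr⟩ := hi
      refine ⟨y, hy, fun z hz hrz => ?_⟩
      obtain ⟨i', hi'⟩ := hι.exists_ordinal hb i.2
      obtain ⟨y', hy'⟩ := hι.exists_ordinal hd hy
      obtain ⟨z', hz'⟩ := hι.exists_ordinal hd hz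
      refine (hι.eq_iff_ordinal_eq hz' hy').1 (hfun i' z' y' ?_ ?_)
      · rwa [hι.pairMemIn_iff, hi', hz']
      · rwa [hι.pairMemIn_iff, hi', hy']
    · exact ⟨0, hδ, fun z hz hrz => (hi ⟨z, hz, hrz⟩).elim⟩
  choose f hfδ hf using hex
  have hsup : ⨆ i, f i + 1 < δ := by
    apply Ordinal.lift_iSup_add_one_lt_of_lt_cof _ hfδ
    rw [Cardinal.mk_Iio_ordinal, ← Ordinal.lift_cof, Cardinal.lift_lift]
    exact Cardinal.lift_lt.2 hlt
  obtain ⟨x, hx⟩ := hι.exists_ordinal hd hsup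
  obtain ⟨i, y, hi, hy, hr, hxy⟩ := hcof x ((hι.mem_ordinal_iff hd).2 ⟨_, hsup, hx⟩)
  obtain ⟨ξ, hξ, hi⟩ := (hι.mem_ordinal_iff hb).1 hi
  obtain ⟨η, hη, hy⟩ := (hι.mem_ordinal_iff hd).1 hy
  rw [hι.mem_iff_lt hx hy, hι.eq_iff_ordinal_eq hx hy, ← le_iff_lt_or_eq] at hxy
  rw [hι.pairMemIn_iff, hi, hy] at hr
  have := hf ⟨ξ, hξ⟩ η hη hr
  have hle : f ⟨ξ, hξ⟩ + 1 ≤ ⨆ i, f i + 1 :=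
    le_ciSup (f := fun i => f i + 1) Ordinal.bddAbove_of_small ⟨ξ, hξ⟩
  rw [← this] at hle
  exact absurd (hle.trans hxy) (by simp)

/-- `ClubIn c d` depends only on the part of `c` below `δ`, and is then the notion of a club in `δ`. -/
theorem clubIn_iff_isClub {c d : S} {δ : Ordinal.{u}} (hd : ι d = δ.toZFSet) :
    ClubIn c d ↔ IsClub {x : Set.Iio δ | x.1.toZFSet ∈ ι c} := by
  rw [isClub_iff, and_comm, ClubIn]
  refine and_congr ⟨fun h => ?_, fun h => ?_⟩ ⟨fun h => ?_, fun h => ?_⟩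
  · rintro ⟨ξ, hξ⟩
    obtain ⟨x, hx⟩ := hι.exists_ordinal hd hξ
    obtain ⟨y, hyd, hyc, hxy⟩ := h x ((hι.mem_ordinal_iff hd).2 ⟨ξ, hξ, hx⟩)
    obtain ⟨η, hη, hy⟩ := (hι.mem_ordinal_iff hd).1 hyd
    rw [hι.mem_iff_lt hx hy, hι.eq_iff_ordinal_eq hx hy, ← le_iff_lt_or_eq] at hxy
    refine ⟨⟨η, hη⟩, ?_, hxy⟩
    rwa [hι.mem_iff, hy] at hyc
  · intro x hx
    obtain ⟨ξ, hξ, hx⟩ := (hι.mem_ordinal_iff hd).1 hx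
    obtain ⟨⟨η, hη⟩, hc, hle⟩ := h ⟨ξ, hξ⟩
    obtain ⟨y, hy⟩ := hι.exists_ordinal hd hη
    refine ⟨y, (hι.mem_ordinal_iff hd).2 ⟨η, hη, hy⟩, ?_, ?_⟩
    · rwa [hι.mem_iff, hy]
    · rw [hι.mem_iff_lt hx hy, hι.eq_iff_ordinal_eq hx hy, ← le_iff_lt_or_eq]
      exact hle
  · rintro t ht ⟨τ, hτ⟩ - ⟨ξ, hξ⟩ hlub
    by_cases hmem : (⟨ξ, hξ⟩ : Set.Iio δ) ∈ t
    · exact ht hmem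
    have hlt : ∀ η ∈ t, η < ⟨ξ, hξ⟩ := fun η hη =>
      (hlub.1 hη).lt_of_ne (fun h => hmem (h ▸ hη))
    obtain ⟨x, hx⟩ := hι.exists_ordinal hd hξ
    have hbelow : ∀ η ∈ t, ∃ y, y ∈' c ∧ y ∈' x ∧ ι y = η.1.toZFSet := by
      intro η hη
      obtain ⟨y, hy⟩ := hι.exists_ordinal hd η.2
      refine ⟨y, ?_, (hι.mem_iff_lt hy hx).2 (hlt η hη), hy⟩
      rw [hι.mem_iff, hy]
      exact ht hη
    have := h x ((hι.mem_ordinal_iff hd).2 ⟨ξ, hξ, hx⟩) ?_ ?_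
    · rwa [hι.mem_iff, hx] at this
    · obtain ⟨y, hyc, hyx, -⟩ := hbelow τ hτ
      exact ⟨y, hyc, hyx⟩
    · intro z hz
      obtain ⟨ζ, hζ, hz⟩ := (hι.mem_ordinal_iff hx).1 hz
      obtain ⟨η, hη, hlt'⟩ := (lt_isLUB_iff hlub).1
        (show (⟨ζ, hζ.trans hξ⟩ : Set.Iio δ) < ⟨ξ, hξ⟩ from hζ)
      obtain ⟨y, hyc, hyx, hy⟩ := hbelow η hη
      exact ⟨y, hyc, hyx, (hι.mem_iff_lt hz hy).2 hlt'⟩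
  · intro x hx ⟨y, hyc, hyx⟩ hlim
    obtain ⟨ξ, hξ, hx⟩ := (hι.mem_ordinal_iff hd).1 hx
    have key := @h {η | η.1.toZFSet ∈ ι c ∧ η.1 < ξ} (fun _ hη => hη.1) ?_
      (.of_linearOrder _) ⟨ξ, hξ⟩ ⟨fun _ hη => hη.2.le, fun β hβ => ?_⟩
    · rw [hι.mem_iff, hx]
      exact key
    · obtain ⟨η, hη, hy⟩ := (hι.mem_ordinal_iff hx).1 hyx
      refine ⟨⟨η, hη.trans hξ⟩, ?_, hη⟩
      rwa [hι.mem_iff, hy] at hyc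
    · by_contra! hlt
      obtain ⟨z, hz⟩ := hι.exists_ordinal hd β.2
      obtain ⟨y, hyc, hyx, hzy⟩ := hlim z ((hι.mem_iff_lt hz hx).2 hlt)
      obtain ⟨η, hη, hy⟩ := (hι.mem_ordinal_iff hx).1 hyx
      rw [hι.mem_iff, hy] at hyc
      exact ((hι.mem_iff_lt hz hy).1 hzy).not_ge
        (hβ (show (⟨η, hη.trans hξ⟩ : Set.Iio δ) ∈ _ from ⟨hyc, hη⟩))

theorem stationaryIn_of_isStationary {a d : S} {δ : Ordinal.{u}} (hd : ι d = δ.toZFSet)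
    (h : IsStationary {x : Set.Iio δ | x.1.toZFSet ∈ ι a}) : StationaryIn a d := by
  intro c hc
  obtain ⟨ξ, hξa, hξc⟩ := h ((hι.clubIn_iff_isClub hd).1 hc)
  obtain ⟨x, hx⟩ := hι.exists_ordinal hd ξ.2
  refine ⟨x, ?_, ?_⟩
  · rwa [hι.mem_iff, hx]
  · rwa [hι.mem_iff, hx]

/-- Stationarity in a transitive class that contains all nonempty subsets of `δ` is genuine. -/
theorem isStationary_of_stationaryIn {a d : S} {δ : Ordinal.{u}} (hd : ι d = δ.toZFSet)
    (hδ : 0 < δ)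
    (hS : ∀ t : Set (Set.Iio δ), t.Nonempty → ∃ c, ∀ x : Set.Iio δ, x.1.toZFSet ∈ ι c ↔ x ∈ t)
    (h : StationaryIn a d) (ha : ∀ x, x ∈' a → x ∈' d) :
    IsStationary {x : Set.Iio δ | x.1.toZFSet ∈ ι a} := by
  intro t ht
  have : Nonempty (Set.Iio δ) := ⟨⟨0, hδ⟩⟩
  obtain ⟨c, hc⟩ := hS t ht.nonempty
  obtain ⟨x, hxa, hxc⟩ := h c ((hι.clubIn_iff_isClub hd).2 (by simpa only [hc] using! ht))
  obtain ⟨ξ, hξ, hx⟩ := (hι.mem_ordinal_iff hd).1 (ha x hxa)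
  rw [hι.mem_iff, hx] at hxa hxc
  exact ⟨⟨ξ, hξ⟩, hxa, (hc _).1 hxc⟩

theorem exists_isNormal_of_normalCopyIn {w a d : S} {α δ : Ordinal.{u}} (hw : ι w = α.toZFSet)
    (hd : ι d = δ.toZFSet) (ha : ∀ x, x ∈' a → x ∈' d) (h : NormalCopyIn w a) :
    ∃ f : Set.Iio α → Set.Iio δ, IsNormal f ∧ ∀ i, (f i).1.toZFSet ∈ ι a := by
  obtain ⟨g, htot, hfun, hmono, hcont⟩ := h
  have hex : ∀ i : Set.Iio α, ∃ y : Set.Iio δ, y.1.toZFSet ∈ ι a ∧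
      ZFSet.pair i.1.toZFSet y.1.toZFSet ∈ ι g := by
    intro i
    obtain ⟨i', hi⟩ := hι.exists_ordinal hw i.2
    obtain ⟨y', hya, hg⟩ := htot i' ((hι.mem_ordinal_iff hw).2 ⟨_, i.2, hi⟩)
    obtain ⟨η, hη, hy⟩ := (hι.mem_ordinal_iff hd).1 (ha y' hya)
    rw [hι.mem_iff, hy] at hya
    rw [hι.pairMemIn_iff, hi, hy] at hg
    exact ⟨⟨η, hη⟩, hya, hg⟩
  choose f hfa hfg using hex
  have hlift : ∀ i : Set.Iio α, ∃ i' y' : S, ι i' = i.1.toZFSet ∧ ι y' = (f i).1.toZFSet ∧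
      i' ∈' w ∧ PairMemIn g i' y' := by
    intro i
    obtain ⟨i', hi⟩ := hι.exists_ordinal hw i.2
    obtain ⟨y', hy⟩ := hι.exists_ordinal hd (f i).2
    refine ⟨i', y', hi, hy, (hι.mem_ordinal_iff hw).2 ⟨_, i.2, hi⟩, ?_⟩
    rw [hι.pairMemIn_iff, hi, hy]
    exact hfg i
  refine ⟨f, isNormal_iff.2 ⟨fun i k hik => ?_, fun i hi y hy => ?_⟩, hfa⟩
  · obtain ⟨i', y', hi, hy, hiw, hgi⟩ := hlift i
    obtain ⟨k', z', hk, hz, hkw, hgk⟩ := hlift k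
    exact (hι.mem_iff_lt hy hz).1
      (hmono i' k' y' z' hiw hkw ((hι.mem_iff_lt hi hk).2 hik) hgi hgk)
  · by_contra! hlt
    obtain ⟨i', y', hi', hy', hiw, hgi⟩ := hlift i
    have hlim : LimitIn i' := by
      rw [hι.limitIn_iff hi', isSuccLimit_iff_exists_between]
      obtain ⟨⟨b, hb⟩, hbtw⟩ := isSuccLimit_iff_exists_between.1 hi
      refine ⟨⟨b.1, hb⟩, fun β hβ => ?_⟩
      obtain ⟨γ, hγ, hlt⟩ := hbtw ⟨β, hβ.trans i.2⟩ hβ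
      exact ⟨γ.1, hγ, hlt⟩
    obtain ⟨z', hz'⟩ := hι.exists_ordinal hd y.2
    obtain ⟨k', x', hki, hgk, hzx⟩ := hcont i' y' hiw hlim hgi z' ((hι.mem_iff_lt hz' hy').2 hlt)
    obtain ⟨k, hk, hk'⟩ := (hι.mem_ordinal_iff hi').1 hki
    obtain ⟨k'', x'', hk'', hx'', -, hgk'⟩ := hlift ⟨k, hk.trans i.2⟩
    obtain rfl : k'' = k' := (hι.eq_iff_ordinal_eq hk'' hk').2 rfl
    obtain rfl := hfun _ _ _ hgk hgk'
    exact ((hι.mem_iff_lt hz' hx'').1 hzx).not_ge (hy ⟨k, hk.trans i.2⟩ hk)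

/-- A normal function whose graph belongs to the transitive class is recognised there. -/
theorem normalCopyIn_of_isNormal {w a d g : S} {α δ : Ordinal.{u}} (hw : ι w = α.toZFSet)
    (hd : ι d = δ.toZFSet) {f : Set.Iio α → Set.Iio δ} (hf : IsNormal f)
    (hfa : ∀ i, (f i).1.toZFSet ∈ ι a)
    (hg : ∀ z, z ∈ ι g ↔ ∃ i, z = ZFSet.pair i.1.toZFSet (f i).1.toZFSet) :
    NormalCopyIn w a := by
  have hpair : ∀ i y : S, PairMemIn g i y ↔
      ∃ k : Set.Iio α, ι i = k.1.toZFSet ∧ ι y = (f k).1.toZFSet := by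
    intro i y
    rw [hι.pairMemIn_iff, hg]
    simp only [ZFSet.pair_inj]
  simp only [NormalCopyIn]
  refine ⟨g, ?_, ?_, ?_, ?_⟩ <;> simp only [hpair]
  · intro i hi
    obtain ⟨ξ, hξ, hi⟩ := (hι.mem_ordinal_iff hw).1 hi
    obtain ⟨y, hy⟩ := hι.exists_ordinal hd (f ⟨ξ, hξ⟩).2
    refine ⟨y, ?_, ⟨ξ, hξ⟩, hi, hy⟩
    rw [hι.mem_iff, hy]
    exact hfa _
  · rintro i y z ⟨k, hk, hy⟩ ⟨k', hk', hz⟩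
    obtain rfl : k = k' := Subtype.ext (toZFSet_injective (hk.symm.trans hk'))
    exact hι.injective (hy.trans hz.symm)
  · rintro i k y z - - hik ⟨i', hi', hy⟩ ⟨k', hk', hz⟩
    exact (hι.mem_iff_lt hy hz).2 (hf.strictMono ((hι.mem_iff_lt hi' hk').1 hik))
  · rintro i y - hlim ⟨i', hi', hy⟩ z hz
    obtain ⟨ζ, hζ, hz⟩ := (hι.mem_ordinal_iff hy).1 hz
    rw [hι.limitIn_iff hi', isSuccLimit_iff_exists_between] at hlim
    have hlim' : IsSuccLimit i' := by
      rw [isSuccLimit_iff_exists_between]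
      obtain ⟨⟨b, hb⟩, hbtw⟩ := hlim
      refine ⟨⟨⟨b, hb.trans i'.2⟩, hb⟩, fun β hβ => ?_⟩
      obtain ⟨γ, hγ, hlt⟩ := hbtw β.1 hβ
      exact ⟨⟨γ, hγ.trans i'.2⟩, hγ, hlt⟩
    obtain ⟨k, hk, hlt⟩ := (hf.lt_iff_exists_lt hlim').1
      (show (⟨ζ, hζ.trans (f i').2⟩ : Set.Iio δ) < f i' from hζ)
    obtain ⟨k₁, hk₁⟩ := hι.exists_ordinal hi' hk
    obtain ⟨x₁, hx₁⟩ := hι.exists_ordinal hd (f k).2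
    exact ⟨k₁, x₁, (hι.mem_iff_lt hk₁ hi').2 hk, ⟨k, hk₁, hx₁⟩, (hι.mem_iff_lt hz hx₁).2 hlt⟩

end IsTransitiveEmbedding

theorem cofinalMapIn_of_cof_le {β δ : Ordinal.{u}} (h : δ.cof ≤ β.card) :
    CofinalMapIn β.toZFSet δ.toZFSet := by
  obtain ⟨s, hs, hcard⟩ := Order.exists_cof_eq (Set.Iio δ)
  have hle : #s ≤ #(Set.Iio β) := by
    rw [hcard, Ordinal.cof_Iio, ← Ordinal.lift_cof, Cardinal.mk_Iio_ordinal]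
    exact Cardinal.lift_le.2 h
  obtain ⟨e⟩ := hle
  have hι := isTransitiveEmbedding_id.{u}
  refine ⟨ZFSet.pairSep (fun i y => ∃ x : s, i = (e x).1.toZFSet ∧ y = x.1.1.toZFSet)
    β.toZFSet δ.toZFSet, ?_, ?_⟩
  · intro i y z hy hz
    rw [hι.pairMemIn_iff] at hy hz
    simp only [id, ZFSet.mem_pairSep, ZFSet.pair_inj] at hy hz
    obtain ⟨_, -, _, -, ⟨rfl, rfl⟩, x, hi, rfl⟩ := hy
    obtain ⟨_, -, _, -, ⟨rfl, rfl⟩, x', hi', rfl⟩ := hz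
    have : x = x' := e.injective (Subtype.ext (toZFSet_injective (hi.symm.trans hi')))
    rw [this]
  · intro x hx
    obtain ⟨ξ, hξ, rfl⟩ := mem_toZFSet_iff.1 hx
    obtain ⟨η, hη, hle⟩ := hs ⟨ξ, hξ⟩
    refine ⟨(e ⟨η, hη⟩).1.toZFSet, η.1.toZFSet, toZFSet_mem_toZFSet_iff.2 (e ⟨η, hη⟩).2,
      toZFSet_mem_toZFSet_iff.2 η.2, ?_, ?_⟩
    · rw [hι.pairMemIn_iff]
      simp only [id, ZFSet.mem_pairSep, ZFSet.pair_inj]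
      exact ⟨_, toZFSet_mem_toZFSet_iff.2 (e ⟨η, hη⟩).2, _, toZFSet_mem_toZFSet_iff.2 η.2,
        ⟨rfl, rfl⟩, _, rfl, rfl⟩
    · exact (lt_or_eq_of_le (show ξ ≤ η.1 from hle)).imp toZFSet_mem_toZFSet_iff.2 (congrArg _)

/-- In the universe of sets, `FriedmanFailsIn` holds whenever `F⁺` fails. -/
theorem friedmanFailsIn_of_not_friedmanPlus {δ : Cardinal.{u}} (h : ¬ FriedmanPlus δ) :
    FriedmanFailsIn (ω : Ordinal.{u}).toZFSet (ω_ 1 : Ordinal.{u}).toZFSet δ.ord.toZFSet := by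
  have hι := isTransitiveEmbedding_id.{u}
  unfold FriedmanPlus at h
  push Not at h
  obtain ⟨A, hA, hstat, hno⟩ := h
  let a : ZFSet.{u} := δ.ord.toZFSet.sep fun z => ∃ x ∈ A, x.1.toZFSet = z
  have ha : ∀ x : Set.Iio δ.ord, x.1.toZFSet ∈ a ↔ x ∈ A := by
    intro x
    simp only [a, ZFSet.mem_sep, toZFSet_injective.eq_iff, toZFSet_mem_toZFSet_iff]
    refine ⟨?_, fun hx => ⟨x.2, x, hx, rfl⟩⟩
    rintro ⟨-, y, hy, hyx⟩
    rwa [← Subtype.ext hyx]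
  have had : ∀ x, x ∈' a → x ∈' δ.ord.toZFSet := fun x hx =>
    have hxa : x ∈ a := hx
    (ZFSet.mem_sep.1 hxa).1
  refine ⟨a, fun x hx => ⟨had x hx, ?_⟩, ?_, fun hcopy => ?_⟩
  · have hxa : x ∈ a := hx
    obtain ⟨-, y, hy, rfl⟩ := ZFSet.mem_sep.1 hxa
    have hcof : y.1.cof = ℵ₀ := hA hy
    refine ⟨(hι.limitIn_iff rfl).2 ?_, cofinalMapIn_of_cof_le (by simp [hcof])⟩
    rw [← Ordinal.one_lt_cof_iff, hcof]
    exact one_lt_aleph0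
  · exact hι.stationaryIn_of_isStationary rfl (by simpa only [id, ha] using! hstat)
  · obtain ⟨f, hf, hfa⟩ := hι.exists_isNormal_of_normalCopyIn rfl rfl had hcopy
    obtain ⟨i, hi⟩ := hno f hf
    exact hi ((ha _).1 (hfa i))

/-! ### Closure of the target of the embedding -/

section Closure

variable {M : Set ZFSet.{u}} {lam : Cardinal.{u}}

/-- Every set of pairs has a range; this instance of Replacement passes to `M` by elementarity. -/
theorem exists_range_of_elementaryEmbedding (j : ZFSet.{u} ↪ₑ[setLanguage] M) (f : M) :
    ∃ c : M, ∀ z, z ∈' c ↔ ∃ x, PairMemIn f x z := by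
  have hFO : IsFirstOrder.{u} (n := 0) fun S _ _ =>
      ∀ f : S, ∃ c : S, ∀ z, z ∈' c ↔ ∃ x, PairMemIn f x z :=
    .all (.ex (.all (.iff (.mem _ _) (.ex (.pairMemIn _ _ _)))))
  refine (hFO.transfer j ![]).2 (fun f => ?_) f
  have hι := isTransitiveEmbedding_id.{u}
  refine ⟨(ZFSet.sUnion (ZFSet.sUnion f)).sep fun z => ∃ x, ZFSet.pair x z ∈ f, fun z => ?_⟩
  simp only [hι.pairMemIn_iff, hι.mem_iff, id, ZFSet.mem_sep, and_iff_right_iff_imp]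
  rintro ⟨x, hx⟩
  exact ZFSet.mem_sUnion.2 ⟨{x, z}, ZFSet.mem_sUnion.2 ⟨_, hx, by simp [ZFSet.pair]⟩, by simp⟩

/-- A class closed under `λ`-sequences, into which the universe embeds elementarily, contains all
images of `λ`. -/
theorem ClosedUnderSeq.exists_image (hcl : ClosedUnderSeq lam M) (hM : IsTransitiveClass M)
    (j : ZFSet.{u} ↪ₑ[setLanguage] M) (g : ZFSet.{u} → ZFSet.{u})
    (hg : ∀ x ∈ cardSet lam, g x ∈ M) :
    ∃ c ∈ M, ∀ z, z ∈ c ↔ ∃ x ∈ cardSet lam, g x = z := by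
  classical
  let _ : ZFSet.Definable₁ g := Classical.allZFSetDefinable _
  have hι := hM.isTransitiveEmbedding
  have hf : ZFSet.map g (cardSet lam) ∈ M := by
    refine hcl (ZFSet.image g (cardSet lam)) _ (fun z hz => ?_)
      (ZFSet.map_isFunc.2 fun z hz => ZFSet.mem_image.2 ⟨z, hz, rfl⟩)
    obtain ⟨x, hx, rfl⟩ := ZFSet.mem_image.1 hz
    exact hg x hx
  obtain ⟨c, hc⟩ := exists_range_of_elementaryEmbedding j ⟨_, hf⟩
  refine ⟨c, c.2, fun z => ⟨fun hz => ?_, ?_⟩⟩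
  · obtain ⟨x, hx⟩ := (hc ⟨z, hM c c.2 z hz⟩).1 hz
    have hp : ZFSet.pair x z ∈ ZFSet.map g (cardSet lam) := hι.pairMemIn_iff.1 hx
    obtain ⟨w, hw, hwz⟩ := ZFSet.mem_map.1 hp
    obtain ⟨rfl, h⟩ := ZFSet.pair_inj.1 hwz
    exact ⟨_, hw, h⟩
  · rintro ⟨x, hx, rfl⟩
    have hp : ZFSet.pair x (g x) ∈ ZFSet.map g (cardSet lam) := ZFSet.mem_map.2 ⟨x, hx, rfl⟩
    -- The pair `{{x}, {x, g x}}` lies in `M`, hence so does `x`, by transitivity.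
    have hxM : x ∈ M := hM _ (hM _ (hM _ hf _ hp) {x} (by simp [ZFSet.pair])) x (by simp)
    exact (hc ⟨g x, hg x hx⟩).2 ⟨⟨x, hxM⟩, hι.pairMemIn_iff.2 hp⟩

/-- A nonempty set of elements of `M` that is the image of part of `λ` belongs to `M`. -/
theorem ClosedUnderSeq.mem_of_subset_image (hcl : ClosedUnderSeq lam M) (hM : IsTransitiveClass M)
    (j : ZFSet.{u} ↪ₑ[setLanguage] M) {c : ZFSet.{u}} (hcM : ∀ z ∈ c, z ∈ M) (hne : c.Nonempty)
    (g : ZFSet.{u} → ZFSet.{u}) (hg : ∀ z ∈ c, ∃ x ∈ cardSet lam, g x = z) : c ∈ M := by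
  classical
  obtain ⟨z₀, hz₀⟩ := hne
  obtain ⟨c', hc', h⟩ := hcl.exists_image hM j (fun x => if g x ∈ c then g x else z₀)
    (fun x _ => by split_ifs with hx; exacts [hcM _ hx, hcM _ hz₀])
  convert hc'
  ext z
  rw [h]
  constructor
  · intro hz
    obtain ⟨x, hx, rfl⟩ := hg z hz
    exact ⟨x, hx, if_pos hz⟩
  · rintro ⟨x, -, rfl⟩
    split_ifs with hx
    exacts [hx, hz₀]

theorem ClosedUnderSeq.pair_mem (hcl : ClosedUnderSeq lam M) (hM : IsTransitiveClass M)
    (j : ZFSet.{u} ↪ₑ[setLanguage] M) (hlam : ℵ₀ ≤ lam) {a b : ZFSet.{u}} (ha : a ∈ M)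
    (hb : b ∈ M) : ZFSet.pair a b ∈ M := by
  classical
  have hfin : ∀ n : ℕ, (n : Ordinal.{u}).toZFSet ∈ cardSet lam := fun n =>
    toZFSet_mem_toZFSet_iff.2
      ((Ordinal.natCast_lt_omega0 n).trans_le (by simpa using Cardinal.ord_le_ord.2 hlam))
  have h01 : ((0 : ℕ) : Ordinal.{u}).toZFSet ≠ ((1 : ℕ) : Ordinal.{u}).toZFSet :=
    fun h => by simpa using toZFSet_injective h
  have hunordered : ∀ x y : ZFSet.{u}, x ∈ M → y ∈ M → ({x, y} : ZFSet) ∈ M := by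
    intro x y hx hy
    refine hcl.mem_of_subset_image hM j ?_ ⟨x, by simp⟩
      (fun z => if z = ((0 : ℕ) : Ordinal.{u}).toZFSet then x else y) ?_
    · simp only [ZFSet.mem_pair]
      rintro z (rfl | rfl) <;> assumption
    · simp only [ZFSet.mem_pair]
      rintro z (rfl | rfl)
      · exact ⟨_, hfin 0, if_pos rfl⟩
      · exact ⟨_, hfin 1, if_neg h01.symm⟩
  have hsingle : ({a} : ZFSet) ∈ M := by simpa [ZFSet.pair_eq_singleton] using hunordered a a ha ha
  exact hunordered _ _ hsingle (hunordered a b ha hb)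

end Closure

/-- If `M` believes that `F⁺(λ)` fails, then it does fail: closure under `λ`-sequences puts into `M`
all clubs of `λ` and the graphs of all functions from `ω₁` to `λ`. -/
theorem not_friedmanPlus_of_friedmanFailsIn {M : Set ZFSet.{u}} {lam : Cardinal.{u}}
    (hcl : ClosedUnderSeq lam M) (hM : IsTransitiveClass M)
    (j : ZFSet.{u} ↪ₑ[setLanguage] M) (hlam : ℵ_ 1 < lam) {o w d : M}
    (ho : (o : ZFSet.{u}) = (ω : Ordinal.{u}).toZFSet)
    (hw : (w : ZFSet.{u}) = (ω_ 1 : Ordinal.{u}).toZFSet) (hd : (d : ZFSet.{u}) = cardSet lam)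
    (h : FriedmanFailsIn o w d) : ¬ FriedmanPlus lam := by
  classical
  intro hF
  have hι := hM.isTransitiveEmbedding
  have hd' : (d : ZFSet.{u}) = lam.ord.toZFSet := hd
  have hord : ω_ 1 < lam.ord := by
    rw [← Cardinal.ord_aleph]
    exact Cardinal.ord_lt_ord.2 hlam
  have hordM : ∀ x : Set.Iio lam.ord, x.1.toZFSet ∈ M := fun x =>
    hM d d.2 _ (by rw [hd']; exact toZFSet_mem_toZFSet_iff.2 x.2)
  obtain ⟨a, ha, hstat, hno⟩ := h
  have had : ∀ x, x ∈' a → x ∈' d := fun x hx => (ha x hx).1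
  have hstat' : IsStationary {x : Set.Iio lam.ord | x.1.toZFSet ∈ (a : ZFSet.{u})} := by
    refine hι.isStationary_of_stationaryIn hd' (zero_le.trans_lt hord)
      (fun t ⟨t₀, ht₀⟩ => ?_) hstat had
    let c : ZFSet.{u} := lam.ord.toZFSet.sep fun z => ∃ x ∈ t, x.1.toZFSet = z
    have hc : c ∈ M := by
      refine hcl.mem_of_subset_image hM j (fun z hz => ?_) ⟨t₀.1.toZFSet, ?_⟩ id (fun z hz => ?_)
      · obtain ⟨-, x, -, rfl⟩ := ZFSet.mem_sep.1 hz
        exact hordM x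
      · exact ZFSet.mem_sep.2 ⟨toZFSet_mem_toZFSet_iff.2 t₀.2, t₀, ht₀, rfl⟩
      · exact ⟨z, (ZFSet.mem_sep.1 hz).1, rfl⟩
    refine ⟨⟨c, hc⟩, fun x => ?_⟩
    simp only [c, ZFSet.mem_sep, toZFSet_injective.eq_iff, toZFSet_mem_toZFSet_iff]
    refine ⟨?_, fun hx => ⟨x.2, x, hx, rfl⟩⟩
    rintro ⟨-, y, hy, hyx⟩
    rwa [← Subtype.ext hyx]
  have hcof : {x : Set.Iio lam.ord | x.1.toZFSet ∈ (a : ZFSet.{u})} ⊆ cofOmega lam.ord := by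
    intro x hx
    obtain ⟨-, hlim, hmap⟩ := ha ⟨_, hordM x⟩ hx
    refine le_antisymm ?_ ?_
    · simpa using hι.cof_le_of_cofinalMapIn ho rfl hmap
    · rw [Ordinal.aleph0_le_cof_iff, Ordinal.one_lt_cof_iff]
      exact (hι.limitIn_iff rfl).1 hlim
  obtain ⟨f, hf, hfa⟩ := hF _ hcof hstat'
  let p : Set.Iio (ω_ 1 : Ordinal.{u}) → ZFSet.{u} := fun i =>
    ZFSet.pair i.1.toZFSet (f i).1.toZFSet
  have hg : ZFSet.range p ∈ M := by
    refine hcl.mem_of_subset_image hM j (fun z hz => ?_)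
      ⟨p ⟨0, Ordinal.omega_pos 1⟩, ZFSet.mem_range_self _⟩
      (fun x => if h : x.rank < ω_ 1 then p ⟨x.rank, h⟩ else ∅) (fun z hz => ?_)
    · obtain ⟨i, rfl⟩ := ZFSet.mem_range.1 hz
      exact hcl.pair_mem hM j ((aleph0_le_aleph 1).trans hlam.le)
        (hordM ⟨i.1, lt_trans i.2 hord⟩) (hordM (f i))
    · obtain ⟨i, rfl⟩ := ZFSet.mem_range.1 hz
      refine ⟨i.1.toZFSet, toZFSet_mem_toZFSet_iff.2 (lt_trans i.2 hord), ?_⟩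
      have hi : i.1 < ω_ 1 := i.2
      simp [rank_toZFSet, hi]
  refine hno (hι.normalCopyIn_of_isNormal (g := ⟨_, hg⟩) hw hd' hf hfa fun z => ?_)
  simp only [ZFSet.mem_range, p, eq_comm]

/-! ### The size of the critical point -/

/-- A `λ`-supercompact cardinal with `λ` regular is larger than `ℵ₁`. -/
theorem IsSupercompactUpTo.aleph_one_lt {kappa lam : Cardinal.{u}} (hle : kappa ≤ lam)
    (hlam : lam.IsRegular) (h : IsSupercompactUpTo kappa lam) : ℵ_ 1 < kappa := by
  obtain ⟨M, j, hM, -, hcrit, -, hj⟩ := h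
  have hι := hM.isTransitiveEmbedding
  let d : M := ⟨cardSet lam, hM _ (j (cardSet kappa)).2 _ hj⟩
  have hd : (d : ZFSet.{u}) = lam.ord.toZFSet := rfl
  have hV := isTransitiveEmbedding_id.{u}
  by_contra! hk
  rcases le_or_gt kappa ℵ₀ with h0 | h0
  · -- No element of a set `κ ≤ ω` is a limit ordinal, but `λ ∈ j(κ)` is one.
    have hFO : IsFirstOrder.{u} (n := 1) fun S _ v => ∀ x : S, x ∈' v 0 → ¬ LimitIn x :=
      .all (.imp (.mem _ _) (.not (.limitIn _)))
    refine (hFO.transfer j ![cardSet kappa]).2 ?_ d hj ((hι.limitIn_iff hd).2 ?_)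
    · intro x hx hlim
      obtain ⟨α, hα, rfl⟩ := mem_toZFSet_iff.1 hx
      have hlt : α < ω := hα.trans_le (by simpa using Cardinal.ord_le_ord.2 h0)
      exact hlt.not_ge (Ordinal.omega0_le_of_isSuccLimit ((hV.limitIn_iff rfl).1 hlim))
    · exact Cardinal.isSuccLimit_ord hlam.aleph0_le
  · -- All elements of `κ = ω₁` have cofinality at most `ω`, but `λ ∈ j(κ)` has not.
    have hFO : IsFirstOrder.{u} (n := 2) fun S _ v => ∀ x : S, x ∈' v 0 → CofinalMapIn (v 1) x :=
      .all (.imp (.mem _ _) (.cofinalMapIn _ _))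
    have hω : (j (ω : Ordinal.{u}).toZFSet : ZFSet.{u}) = (ω : Ordinal.{u}).toZFSet :=
      hcrit _ (by rw [← ord_aleph0]; exact Cardinal.ord_lt_ord.2 h0)
    have hmap : CofinalMapIn (j (ω : Ordinal.{u}).toZFSet) d := by
      refine (hFO.transfer j ![cardSet kappa, (ω : Ordinal.{u}).toZFSet]).2 ?_ d hj
      intro x hx
      obtain ⟨α, hα, rfl⟩ := mem_toZFSet_iff.1 hx
      refine cofinalMapIn_of_cof_le ((Ordinal.cof_le_card α).trans ?_)
      rw [card_omega0, ← Order.lt_succ_iff, ← Cardinal.aleph_zero, Cardinal.succ_aleph]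
      refine (Cardinal.lt_ord.1 hα).trans_le ?_
      simpa using hk
    have := hι.cof_le_of_cofinalMapIn hω hd hmap
    rw [hlam.cof_ord, card_omega0] at this
    exact (h0.trans_le hle).not_ge this

theorem mainTheorem7 (kappa lam : Cardinal.{u}) (hle : kappa ≤ lam) (hlam : lam.IsRegular)
    (hsc : IsSupercompactUpTo kappa lam)
    (hfail : ∀ δ : Cardinal.{u}, δ.IsRegular → ℵ_ 2 ≤ δ → δ < kappa → ¬ FriedmanPlus δ) :
    ¬ FriedmanPlus lam := by
  have hk := hsc.aleph_one_lt hle hlam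
  obtain ⟨M, j, hM, hcl, hcrit, -, hj⟩ := hsc
  have hι := hM.isTransitiveEmbedding
  have hV := isTransitiveEmbedding_id.{u}
  have hkord : ω_ 1 < kappa.ord := by
    rw [← Cardinal.ord_aleph]
    exact Cardinal.ord_lt_ord.2 hk
  have hω : (j (ω : Ordinal.{u}).toZFSet : ZFSet.{u}) = (ω : Ordinal.{u}).toZFSet :=
    hcrit _ ((Ordinal.omega0_le_omega 1).trans_lt hkord)
  have hω₁ : (j (ω_ 1 : Ordinal.{u}).toZFSet : ZFSet.{u}) = (ω_ 1 : Ordinal.{u}).toZFSet :=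
    hcrit _ hkord
  let d : M := ⟨cardSet lam, hM _ (j (cardSet kappa)).2 _ hj⟩
  have hd : (d : ZFSet.{u}) = lam.ord.toZFSet := rfl
  -- The hypothesis on the regular cardinals between `ω₁` and `κ`, as a first-order statement.
  have hFO : IsFirstOrder.{u} (n := 3) fun S _ v => ∀ δ : S, δ ∈' v 0 → v 2 ∈' δ →
      (∀ β, β ∈' δ → ¬ CofinalMapIn β δ) → FriedmanFailsIn (v 1) (v 2) δ :=
    .all (.imp (.mem _ _) (.imp (.mem _ _) (.imp
      (.all (.imp (.mem _ _) (.not (.cofinalMapIn _ _)))) (.friedmanFailsIn _ _ _))))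
  refine not_friedmanPlus_of_friedmanFailsIn hcl hM j (hk.trans_le hle) hω hω₁ (d := d) rfl ?_
  refine (hFO.transfer j ![cardSet kappa, (ω : Ordinal.{u}).toZFSet,
    (ω_ 1 : Ordinal.{u}).toZFSet]).2 ?_ d hj ?_ ?_
  · intro x hx hωx hreg
    obtain ⟨δ, hδ, rfl⟩ := mem_toZFSet_iff.1 hx
    have hωδ : ω_ 1 < δ := toZFSet_mem_toZFSet_iff.1 hωx
    have hcof : δ.cof.ord = δ := by
      refine (Ordinal.ord_cof_le δ).eq_of_not_lt fun hlt => ?_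
      exact hreg _ (toZFSet_mem_toZFSet_iff.2 hlt) (cofinalMapIn_of_cof_le (by simp))
    have hlt : ℵ_ 1 < δ.cof := by
      rw [← Cardinal.ord_lt_ord, hcof, Cardinal.ord_aleph]
      exact hωδ
    rw [← hcof]
    refine friedmanFailsIn_of_not_friedmanPlus (hfail _ ?_ ?_ ?_)
    · exact ⟨(aleph0_le_aleph 1).trans hlt.le, by simp⟩
    · rw [← one_add_one_eq_two, ← Cardinal.succ_aleph]
      exact Order.succ_le_of_lt hlt
    · rw [← Cardinal.ord_lt_ord, hcof]
      exact hδ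
  · refine (hι.mem_iff_lt hω₁ hd).2 ?_
    exact hkord.trans_le (Cardinal.ord_le_ord.2 hle)
  · intro β hβ hmap
    obtain ⟨β', hlt, hβ'⟩ := (hι.mem_ordinal_iff hd).1 hβ
    have := hι.cof_le_of_cofinalMapIn hβ' hd hmap
    rw [hlam.cof_ord] at this
    exact (Cardinal.lt_ord.1 hlt).not_ge this
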